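/- **Theorem 2.7.** For $r\ge 1$ let $\vec 1_r=(1/\sqrt r,\dots,1/\sqrt r)^T\in\mathbb R^r$; for a square real matrix $M$ let $\chi(M)=\det(xI-M)$; for a polynomial $p$ let $\mathbb S\{p\}(x)=p(x^2)$; for an $m\times n$ matrix $A$ let $\mathrm{bip}(A)=\begin{pmatrix}0&A\\A^T&0\end{pmatrix}$; and let $P\oplus S=\begin{pmatrix}P&0\\0&S\end{pmatrix}$. For integers $M\ge N\ge 0$ and polynomials $p=\sum_{i=0}^N(-1)^i a_i x^{N-i}$, $q=\sum_{i=0}^N(-1)^i b_i x^{N-i}$ put $$p\boxplus_{M,N}q=\sum_{\ell=0}^N x^{N-\ell}(-1)^\ell\sum_{i+j=\ell}\frac{(N-i)!\,(N-j)!}{N!\,(N-\ell)!}\,\frac{(M-i)!\,(M-j)!}{M!\,(M-\ell)!}\,a_i b_j .$$ Let $m\ge n\ge 1$, let $a,b\in\mathbb R$ and let $A,B$ be real $m\times n$ matrices with $$A\vec 1_n=a\vec 1_m,\quad A^T\vec 1_m=a\vec 1_n,\quad B\vec 1_n=b\vec 1_m,\quad B^T\vec 1_m=b\vec 1_n .$$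 Then $x-a^2$ divides $\chi(A^TA)$ and $x-b^2$ divides $\chi(B^TB)$, and if $\chi(A^TA)=(x-a^2)\,p(x)$ and $\chi(B^TB)=(x-b^2)\,q(x)$, then, for $P$ and $S$ independent uniformly random $m\times m$ and $n\times n$ permutation matrices, $$\mathbb E_{P,S}\,\chi\big(\mathrm{bip}(A)+(P\oplus S)\,\mathrm{bip}(B)\,(P\oplus S)^T\big)=x^{m-n}\,\mathbb S\big\{(x-(a+b)^2)\,(p\boxplus_{m-1,n-1}q)\big\}=x^{m-n}\,\big(x^2-(a+b)^2\big)\,\mathbb S\{p\boxplus_{m-1,n-1}q\}.$$ -/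

import Mathlib

open Polynomial
open scoped Matrix BigOperators Nat

noncomputable section

/-- The normalized all-ones vector `(1/√r, …, 1/√r)` in `ℝ^r`. -/
def normalizedOnes (r : ℕ) : Fin r → ℝ := fun _ => 1 / √(r : ℝ)

/-- The symmetric bipartite matrix with zero diagonal blocks and
off-diagonal blocks `A` and `Aᵀ`. -/
def bipartite {m n : ℕ} (A : Matrix (Fin m) (Fin n) ℝ) :
    Matrix (Fin m ⊕ Fin n) (Fin m ⊕ Fin n) ℝ :=
  Matrix.fromBlocks 0 A Aᵀ 0

/-- The direct sum `P ⊕ S` (block diagonal matrix) of two square matrices. -/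
def directSum {m n : ℕ} (P : Matrix (Fin m) (Fin m) ℝ) (S : Matrix (Fin n) (Fin n) ℝ) :
    Matrix (Fin m ⊕ Fin n) (Fin m ⊕ Fin n) ℝ :=
  Matrix.fromBlocks P 0 0 S

/-- The operator `p(x) ↦ p(x²)` on polynomials. -/
def squareSubst (p : ℝ[X]) : ℝ[X] := p.comp (X ^ 2)

/-- The number `a_i` in the expansion `p(x) = ∑_{i ≤ n} (-1)^i a_i x^{n-i}` of a polynomial
of degree (at most) `n`. -/
def signedCoeff (n : ℕ) (p : ℝ[X]) (i : ℕ) : ℝ := (-1) ^ i * p.coeff (n - i)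

/-- The rectangular additive convolution `p ⊞_{m,n} q` of two polynomials of degree `n`,
for `n ≤ m`. In all terms `i, j ≤ ℓ ≤ n ≤ m`, so no subtraction truncates. -/
def rectConv (m n : ℕ) (p q : ℝ[X]) : ℝ[X] :=
  ∑ l ∈ Finset.range (n + 1),
    C ((-1) ^ l * ∑ ij ∈ Finset.HasAntidiagonal.antidiagonal l,
      (((n - ij.1)! : ℝ) * ((n - ij.2)! : ℝ)) / ((n ! : ℝ) * ((n - l)! : ℝ)) *
      ((((m - ij.1)! : ℝ) * ((m - ij.2)! : ℝ)) / ((m ! : ℝ) * ((m - l)! : ℝ))) *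
      signedCoeff n p ij.1 * signedCoeff n q ij.2) * X ^ (n - l)

end

/-! Conjugation by `P ⊕ S` turns the random matrix into the bipartite matrix of `M = A + P B Sᵀ`,
whose characteristic polynomial is `x^(m-n)` times that of `MᵀM` at `x²`. The normalized all-ones
vectors are singular vectors of `A`, `B` and every `M`, with values `a`, `b`, `a + b`. Subtracting
these rank one parts replaces the factor `x - c²` of the characteristic polynomial by `x`,
compatibly with the sum. It remains to treat `A`, `B` with zero row and column sums and to show that
the expectation of `χ(MᵀM)` is `x (p ⊞ q)`.

Up to sign, coefficients are sums of principal minors. With `J` the projection onto vectors of sum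
zero, `M = [A | P B] [J | S J]ᵀ`. By Cauchy–Binet the minor sums of `MᵀM` are bilinear in the minors
of the Gram matrices of `[A | P B]` and `[J | S J]`, and independence separates the two
expectations.

The key is `expect_det_gram_submatrix`: if the columns of `U` and `V` have sum zero, the expected
minor of the Gram matrix of `[U | P V]` is the same minor of `UᵀU ⊕ VᵀV` times a weight depending
only on the dimension, the size of the minor and the number of rows chosen in the second block. This
is a Schur-type statement. Invariance of `P` under multiplication on both sides kills the
off-diagonal minors in coordinates of the sum-zero spaces and equates the diagonal ones of the same
type. The weights follow from the test case `U = V = J`. A second use of Cauchy–Binet reassembles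
the minors, and the weights for `m` and `n` multiply to the coefficients of `⊞`. -/

namespace Matrix

/-! ### Cauchy–Binet and sums of principal minors. -/

section MinorSum

variable {R ι κ τ : Type*} [CommRing R] [Fintype κ] [DecidableEq κ]

theorem det_mul_eq_sum_prod_mul_det [Fintype ι] (A : Matrix κ ι R) (B : Matrix ι κ R) :
    (A * B).det = ∑ g : κ → ι, (∏ c, A c (g c)) * (B.submatrix g id).det := by
  have h : A * B = fun c => ∑ j, A c j • B j := by
    ext c d
    simp [mul_apply]
  calc (A * B).det = (detRowAlternating (R := R) (n := κ)).toMultilinearMap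
        (fun c => ∑ j, A c j • B j) := by rw [h]; rfl
    _ = _ := by
      rw [MultilinearMap.map_sum]
      refine Finset.sum_congr rfl fun g _ => ?_
      rw [MultilinearMap.map_smul_univ]
      rfl

/-- A form of the Cauchy–Binet formula in which one sums over functions instead of subsets. -/
theorem factorial_card_mul_det_mul [Fintype ι] (A : Matrix κ ι R) (B : Matrix ι κ R) :
    ((Fintype.card κ)! : R) * (A * B).det =
      ∑ g : κ → ι, (A.submatrix id g).det * (B.submatrix g id).det := by
  -- Permuting the rows of both factors by `σ` costs two equal signs, so every `σ` gives the same
  -- sum. Summing over `σ` assembles the products of entries of `A` into its minors.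
  have h : ∀ σ : Equiv.Perm κ,
      ∑ g : κ → ι, (((Equiv.Perm.sign σ : ℤ) : R) * ∏ c, A (σ c) (g c)) *
        (B.submatrix g id).det = (A * B).det := by
    intro σ
    rw [det_mul_eq_sum_prod_mul_det]
    refine (Fintype.sum_equiv (Equiv.arrowCongr σ (Equiv.refl ι)) _ _ fun g => ?_)
    have h1 : (B.submatrix g id).det =
        ((Equiv.Perm.sign σ : ℤ) : R) * (B.submatrix (g ∘ σ.symm) id).det := by
      rw [← det_permute]
      congr 1
      ext c d
      simp
    have h2 : ∏ c, A (σ c) (g c) = ∏ c, A c (g (σ.symm c)) :=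
      Fintype.prod_equiv σ _ _ fun c => by simp
    have h3 : ((Equiv.Perm.sign σ : ℤ) : R) * ((Equiv.Perm.sign σ : ℤ) : R) = 1 := by
      rw [← Int.cast_mul, ← Units.val_mul, Int.units_mul_self]; simp
    rw [h1, h2]
    rw [mul_mul_mul_comm, h3, one_mul]
    congr 1
  calc ((Fintype.card κ)! : R) * (A * B).det = ∑ _σ : Equiv.Perm κ, (A * B).det := by
        simp [Fintype.card_perm]
    _ = ∑ σ : Equiv.Perm κ, ∑ g : κ → ι, (((Equiv.Perm.sign σ : ℤ) : R) * ∏ c, A (σ c) (g c)) *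
        (B.submatrix g id).det := (Finset.sum_congr rfl fun σ _ => h σ).symm
    _ = _ := by
      rw [Finset.sum_comm]
      refine Finset.sum_congr rfl fun g _ => ?_
      rw [← Finset.sum_mul, det_apply' (A.submatrix id g)]
      rfl

/-- The sum of all `k × k` principal minors indexed by functions `Fin k → ι`, which is `k !` times
the sum of the principal minors indexed by subsets of size `k`. -/
def minorSum [Fintype ι] (k : ℕ) (N : Matrix ι ι R) : R := ∑ f : Fin k → ι, (N.submatrix f f).det

theorem factorial_mul_minorSum_mul [Fintype ι] [Fintype τ] (k : ℕ) (A : Matrix ι τ R) (B : Matrix τ ι R) :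
    (k ! : R) * minorSum k (A * B) =
      ∑ f : Fin k → ι, ∑ g : Fin k → τ, (A.submatrix f g).det * (B.submatrix g f).det := by
  rw [minorSum, Finset.mul_sum]
  refine Finset.sum_congr rfl fun f _ => ?_
  have h := factorial_card_mul_det_mul (A.submatrix f id) (B.submatrix id f)
  rw [Fintype.card_fin] at h
  exact h

/-- The Cauchy–Binet double sum is symmetric in the two factors, even when their index types differ
in size. -/
theorem minorSum_mul_comm [Fintype ι] [Fintype τ] [IsDomain R] [CharZero R] (k : ℕ) (A : Matrix ι τ R)
    (B : Matrix τ ι R) : minorSum k (A * B) = minorSum k (B * A) := by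
  have hk : (k ! : R) ≠ 0 := Nat.cast_ne_zero.mpr (Nat.factorial_ne_zero k)
  apply mul_left_cancel₀ hk
  rw [factorial_mul_minorSum_mul, factorial_mul_minorSum_mul, Finset.sum_comm]
  simp only [mul_comm]

theorem minorSum_smul [Fintype ι] (k : ℕ) (y : R) (N : Matrix ι ι R) :
    minorSum k (y • N) = y ^ k * minorSum k N := by
  simp [minorSum, Finset.mul_sum, submatrix_smul]

theorem det_submatrix_eq_zero_of_not_injective (N : Matrix ι τ R) {f : κ → ι} (g : κ → τ)
    (hf : ¬ Function.Injective f) : (N.submatrix f g).det = 0 := by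
  obtain ⟨i, j, hij, hne⟩ : ∃ i j, f i = f j ∧ i ≠ j := by
    simpa [Function.Injective] using hf
  exact det_zero_of_row_eq hne (by ext; simp [hij])

theorem det_submatrix_eq_zero_of_not_injective' (N : Matrix ι τ R) (f : κ → ι) {g : κ → τ}
    (hg : ¬ Function.Injective g) : (N.submatrix f g).det = 0 := by
  rw [← det_transpose, transpose_submatrix, det_submatrix_eq_zero_of_not_injective _ _ hg]

theorem minorSum_eq_factorial_mul_sum_powersetCard [Fintype ι] [DecidableEq ι] (k : ℕ) (N : Matrix ι ι R) :
    minorSum k N = (k ! : R) * ∑ s ∈ Finset.univ.powersetCard k,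
      (N.submatrix (Subtype.val : s → ι) (Subtype.val : s → ι)).det := by
  have h0 : minorSum k N = ∑ f : Fin k → ι with Function.Injective f, (N.submatrix f f).det := by
    rw [minorSum, Finset.sum_filter]
    refine Finset.sum_congr rfl fun f _ => ?_
    split_ifs with hf
    · rfl
    · exact det_submatrix_eq_zero_of_not_injective _ _ hf
  have hmaps : ∀ f ∈ ({f : Fin k → ι | Function.Injective f} : Finset (Fin k → ι)),
      Finset.univ.image f ∈ (Finset.univ : Finset ι).powersetCard k := by
    intro f hf
    rw [Finset.mem_filter] at hf
    simp [Finset.mem_powersetCard, Finset.card_image_of_injective _ hf.2]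
  rw [h0, ← Finset.sum_fiberwise_of_maps_to hmaps, Finset.mul_sum]
  refine Finset.sum_congr rfl fun s hs => ?_
  have hsc : Fintype.card s = k := by simpa using (Finset.mem_powersetCard.mp hs).2
  have hcard : Fintype.card (Fin k ≃ s) = k ! := by
    rw [Fintype.card_equiv (Fintype.equivOfCardEq (by simp [hsc]))]
    simp
  rw [← hcard, ← Finset.card_univ, ← nsmul_eq_mul, ← Finset.sum_const]
  symm
  refine Finset.sum_bij (fun (e : Fin k ≃ s) _ => fun c => ((e c : s) : ι)) ?_ ?_ ?_ ?_
  · intro e _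
    simp only [Finset.mem_filter, Finset.mem_univ, true_and]
    refine ⟨Subtype.val_injective.comp e.injective, ?_⟩
    ext x
    simp only [Finset.mem_image, Finset.mem_univ, true_and]
    constructor
    · rintro ⟨c, rfl⟩; exact (e c).2
    · intro hx; exact ⟨e.symm ⟨x, hx⟩, by simp⟩
  · intro e _ e' _ h
    ext c
    exact congrFun h c
  · intro f hf
    simp only [Finset.mem_filter, Finset.mem_univ, true_and] at hf
    have hmem : ∀ c, f c ∈ s := fun c => by rw [← hf.2]; simp
    refine ⟨Equiv.ofBijective (fun c => (⟨f c, hmem c⟩ : s)) ?_, Finset.mem_univ _, rfl⟩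
    rw [Fintype.bijective_iff_injective_and_card]
    refine ⟨fun c d h => hf.1 (congrArg Subtype.val h), by simp [hsc]⟩
  · intro e _
    rw [← det_submatrix_equiv_self e]
    rfl

theorem factorial_mul_coeff_det_one_add_X_smul [Fintype ι] [DecidableEq ι] (k : ℕ) (N : Matrix ι ι R) :
    (k ! : R) * (det (1 + (X : R[X]) • N.map C)).coeff k = minorSum k N := by
  rw [coeff_det_one_add_X_smul_eq_sum_minors, minorSum_eq_factorial_mul_sum_powersetCard]

theorem factorial_mul_charpoly_coeff [Fintype ι] [DecidableEq ι] (N : Matrix ι ι R) {k : ℕ} (hk : k ≤ Fintype.card ι) :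
    (k ! : R) * N.charpoly.coeff (Fintype.card ι - k) = (-1) ^ k * minorSum k N := by
  rw [charpoly_coeff_eq_sum_minors _ _ hk, minorSum_eq_factorial_mul_sum_powersetCard]
  ring

/-- The generating function `det (1 + X N)` is multiplicative on block diagonal matrices; the
binomial coefficient comes from indexing minors by functions. -/
theorem minorSum_fromBlocks [Fintype ι] [DecidableEq ι] [Fintype τ] [DecidableEq τ]
     (k : ℕ) (G : Matrix ι ι R) (H : Matrix τ τ R) :
    minorSum k (fromBlocks G 0 0 H) = ∑ j ∈ Finset.range (k + 1),
      (k.choose j : R) * minorSum (k - j) G * minorSum j H := by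
  have hdet : det (1 + (X : R[X]) • (fromBlocks G 0 0 H).map C) =
      det (1 + (X : R[X]) • H.map C) * det (1 + (X : R[X]) • G.map C) := by
    rw [fromBlocks_map, ← fromBlocks_one, fromBlocks_smul, fromBlocks_add]
    simp only [map_zero, Matrix.map_zero, smul_zero, add_zero]
    rw [det_fromBlocks_zero₂₁, mul_comm]
  rw [← factorial_mul_coeff_det_one_add_X_smul, hdet, coeff_mul,
    Finset.Nat.sum_antidiagonal_eq_sum_range_succ_mk, Finset.mul_sum]
  refine Finset.sum_congr rfl fun j hj => ?_
  have hjk : j ≤ k := Nat.lt_succ_iff.mp (Finset.mem_range.mp hj)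
  rw [← factorial_mul_coeff_det_one_add_X_smul, ← factorial_mul_coeff_det_one_add_X_smul,
    ← Nat.choose_mul_factorial_mul_factorial hjk]
  push_cast
  ring

end MinorSum

end Matrix

namespace Matrix

/-! ### Coordinates on vectors with sum zero in each block. -/

section BlockBase

variable {α κ : Type*}

/-- The base point of the block of `α ⊕ α` that contains a given point. -/
def blockBase (o : α) : α ⊕ α → α ⊕ α := Sum.map (fun _ => o) (fun _ => o)

theorem blockBase_blockBase (o : α) (ρ : α ⊕ α) : blockBase o (blockBase o ρ) = blockBase o ρ := by
  cases ρ <;> rfl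

/-- The matrix whose rows are the rows of `N` minus the row of the base point of the block. -/
def rowDiff {σ : Type*} (o : α) (N : Matrix (α ⊕ α) σ ℝ) : Matrix (α ⊕ α) σ ℝ :=
  of fun ρ x => N ρ x - N (blockBase o ρ) x

theorem rowDiff_blockBase {σ : Type*} (o : α) (N : Matrix (α ⊕ α) σ ℝ) (ρ : α ⊕ α) (x : σ) :
    rowDiff o N (blockBase o ρ) x = 0 := by
  simp [rowDiff, blockBase_blockBase]

theorem transpose_mul_rowDiff [Fintype α] {σ : Type*} (o : α) (N : Matrix (α ⊕ α) σ ℝ)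
    (V : Matrix (α ⊕ α) κ ℝ) (h₁ : ∀ c, ∑ r, V (Sum.inl r) c = 0)
    (h₂ : ∀ c, ∑ r, V (Sum.inr r) c = 0) : Vᵀ * rowDiff o N = Vᵀ * N := by
  ext c x
  simp only [mul_apply, transpose_apply, rowDiff, of_apply, mul_sub, Finset.sum_sub_distrib,
    sub_eq_self, Fintype.sum_sum_type, blockBase, Sum.map_inl, Sum.map_inr, ← Finset.sum_mul,
    h₁, h₂, zero_mul, add_zero]

theorem mul_rowDiff [Fintype α] {σ : Type*} (o : α) (N : Matrix σ (α ⊕ α) ℝ)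
    (V : Matrix (α ⊕ α) κ ℝ) (h₁ : ∀ x, ∑ r, N x (Sum.inl r) = 0)
    (h₂ : ∀ x, ∑ r, N x (Sum.inr r) = 0) : N * rowDiff o V = N * V := by
  ext x c
  simp only [mul_apply, rowDiff, of_apply, mul_sub, Finset.sum_sub_distrib,
    sub_eq_self, Fintype.sum_sum_type, blockBase, Sum.map_inl, Sum.map_inr, ← Finset.sum_mul,
    h₁, h₂, zero_mul, add_zero]

/-- Zero block sums allow base rows to be subtracted from `N` and then from `V'` without changing
the product. In the resulting expansion every term in which `f` or `g` hits a base point vanishes.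
-/
theorem det_transpose_mul_mul_eq_sum [Fintype α] [Fintype κ] [DecidableEq κ] (o : α) (N : Matrix (α ⊕ α) (α ⊕ α) ℝ)
    (V V' : Matrix (α ⊕ α) κ ℝ)
    (h₁ : ∀ c, ∑ r, V (Sum.inl r) c = 0) (h₂ : ∀ c, ∑ r, V (Sum.inr r) c = 0)
    (hN₁ : ∀ ρ, ∑ r, rowDiff o N ρ (Sum.inl r) = 0)
    (hN₂ : ∀ ρ, ∑ r, rowDiff o N ρ (Sum.inr r) = 0) :
    (Vᵀ * N * V').det = ∑ f : κ → α ⊕ α, ∑ g : κ → α ⊕ α,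
      ((∏ c, V (f c) c) * ∏ c, rowDiff o V' (g c) c) * ((rowDiff o N).submatrix f g).det := by
  rw [← transpose_mul_rowDiff o N V h₁ h₂, Matrix.mul_assoc, ← mul_rowDiff o _ V' hN₁ hN₂,
    det_mul_eq_sum_prod_mul_det]
  refine Finset.sum_congr rfl fun f _ => ?_
  have h : (rowDiff o N * rowDiff o V').submatrix f id =
      (rowDiff o N).submatrix f id * rowDiff o V' := rfl
  rw [h, ← det_transpose, transpose_mul, det_mul_eq_sum_prod_mul_det, Finset.mul_sum]
  refine Finset.sum_congr rfl fun g _ => ?_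
  rw [← det_transpose, mul_assoc]
  rfl

end BlockBase

/-! ### Expected minors of the Gram matrix of `[1 | P]`. -/

section PermGram

variable {α κ : Type*} [Fintype α] [DecidableEq α] [Fintype κ] [DecidableEq κ]

/-- The Gram matrix of the columns of `[1 | P]` for a permutation matrix `P`. -/
def permGram (P : Equiv.Perm α) : Matrix (α ⊕ α) (α ⊕ α) ℝ :=
  fromBlocks 1 (P.permMatrix ℝ) (P.permMatrix ℝ)ᵀ 1

omit [Fintype α] in
theorem permMatrix_apply_eq_ite (P : Equiv.Perm α) (r s : α) :
    P.permMatrix ℝ r s = if P r = s then 1 else 0 := by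
  simp [PEquiv.toMatrix_apply, eq_comm]

omit [Fintype α] in
theorem permGram_submatrix_sumCongr (P τ₁ τ₂ : Equiv.Perm α) :
    (permGram P).submatrix (Equiv.sumCongr τ₁ τ₂) (Equiv.sumCongr τ₁ τ₂) =
      permGram (τ₂⁻¹ * P * τ₁) := by
  ext (r | r) (s | s)
  · simp [permGram, one_apply]
  · simp only [permGram, submatrix_apply, Equiv.sumCongr_apply, Sum.map_inl, Sum.map_inr,
      fromBlocks_apply₁₂, permMatrix_apply_eq_ite, Equiv.Perm.mul_apply, Equiv.Perm.inv_eq_iff_eq]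
  · simp only [permGram, submatrix_apply, Equiv.sumCongr_apply, Sum.map_inl, Sum.map_inr,
      fromBlocks_apply₂₁, transpose_apply, permMatrix_apply_eq_ite, Equiv.Perm.mul_apply,
      Equiv.Perm.inv_eq_iff_eq]
  · simp [permGram, one_apply]

/-- Relabelling the blocks replaces `P` by `τ₂⁻¹ * P * τ₁`, which is again uniform. This is the only
property of the uniform distribution that is used to restrict the expected minors. -/
theorem expect_permGram_submatrix_sumCongr (τ₁ τ₂ : Equiv.Perm α)
    (F : Matrix (α ⊕ α) (α ⊕ α) ℝ → ℝ) :
    𝔼 P : Equiv.Perm α,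
        F ((permGram P).submatrix (Equiv.sumCongr τ₁ τ₂) (Equiv.sumCongr τ₁ τ₂)) =
      𝔼 P : Equiv.Perm α, F (permGram P) := by
  simp only [permGram_submatrix_sumCongr]
  exact Fintype.expect_equiv ((Equiv.mulLeft τ₂⁻¹).trans (Equiv.mulRight τ₁)) _ _ fun P => rfl

theorem sum_rowDiff_permGram_inl (o : α) (P : Equiv.Perm α) (ρ : α ⊕ α) :
    ∑ r, rowDiff o (permGram P) ρ (Sum.inl r) = 0 := by
  have h : ∀ r, ∑ s, (if P s = r then (1 : ℝ) else 0) = 1 := fun r => by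
    simp [← Equiv.eq_symm_apply]
  cases ρ
  · simp [rowDiff, permGram, blockBase, one_apply]
  · simp only [rowDiff, permGram, blockBase, of_apply, Sum.map_inr, fromBlocks_apply₂₁,
      transpose_apply, permMatrix_apply_eq_ite, Finset.sum_sub_distrib, h, sub_self]

theorem sum_rowDiff_permGram_inr (o : α) (P : Equiv.Perm α) (ρ : α ⊕ α) :
    ∑ r, rowDiff o (permGram P) ρ (Sum.inr r) = 0 := by
  cases ρ <;> simp [rowDiff, permGram, blockBase, one_apply]

theorem sum_rowDiff_one_inl (o : α) (ρ : α ⊕ α) :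
    ∑ r, rowDiff o (1 : Matrix (α ⊕ α) (α ⊕ α) ℝ) ρ (Sum.inl r) = 0 := by
  cases ρ <;> simp [rowDiff, blockBase, one_apply]

theorem sum_rowDiff_one_inr (o : α) (ρ : α ⊕ α) :
    ∑ r, rowDiff o (1 : Matrix (α ⊕ α) (α ⊕ α) ℝ) ρ (Sum.inr r) = 0 := by
  cases ρ <;> simp [rowDiff, blockBase, one_apply]

omit [Fintype α] in
theorem exists_sumCongr_eq_swap_blockBase (o : α) (ρ : α ⊕ α) :
    ∃ τ₁ τ₂ : Equiv.Perm α, Equiv.sumCongr τ₁ τ₂ = Equiv.swap ρ (blockBase o ρ) := by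
  rcases ρ with r | r
  · exact ⟨Equiv.swap r o, 1, Equiv.Perm.sumCongr_swap_refl r o⟩
  · exact ⟨1, Equiv.swap r o, Equiv.Perm.sumCongr_refl_swap r o⟩

omit [Fintype α] in
-- Exchanging a point with its base point acts on row differences as a reflection, of determinant
-- `-1`. The columns do not move, since `g` avoids both points.
theorem det_rowDiff_submatrix_swap (o : α) (N : Matrix (α ⊕ α) (α ⊕ α) ℝ) {f g : κ → α ⊕ α}
    (hf : ∀ c ρ, f c ≠ blockBase o ρ) (hg : ∀ c ρ, g c ≠ blockBase o ρ)
    {c₀ : κ} (hc : ∀ c, g c ≠ f c₀) :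
    ((rowDiff o (N.submatrix (Equiv.swap (f c₀) (blockBase o (f c₀)))
      (Equiv.swap (f c₀) (blockBase o (f c₀))))).submatrix f g).det =
      - ((rowDiff o N).submatrix f g).det := by
  -- The swap negates the difference at `f c₀`, which is adding `-2` times it, and subtracts it once
  -- from the other differences in the same block. The row operation is therefore `1 + lam e_{c₀}ᵀ`,
  -- of determinant `1 + lam c₀ = -1`.
  set lam : κ → ℝ := fun c => if f c = f c₀ then -2 else
    if blockBase o (f c) = blockBase o (f c₀) then -1 else 0 with hlam
  have h : (rowDiff o (N.submatrix (Equiv.swap (f c₀) (blockBase o (f c₀)))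
      (Equiv.swap (f c₀) (blockBase o (f c₀))))).submatrix f g =
      (1 + replicateCol Unit lam * replicateRow Unit (Pi.single c₀ (1 : ℝ))) *
        (rowDiff o N).submatrix f g := by
    ext c d
    have h1 : ((1 + replicateCol Unit lam * replicateRow Unit (Pi.single c₀ (1 : ℝ)) :
        Matrix κ κ ℝ) * (rowDiff o N).submatrix f g) c d =
        rowDiff o N (f c) (g d) + lam c * rowDiff o N (f c₀) (g d) := by
      rw [add_mul, one_mul, add_apply, mul_apply]
      simp [mul_apply, Pi.single_apply]
    rw [h1]
    simp only [submatrix_apply, rowDiff, of_apply,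
      Equiv.swap_apply_of_ne_of_ne (hc d) (hg d (f c₀)), hlam]
    by_cases h2 : f c = f c₀
    · simp only [h2, Equiv.swap_apply_left, Equiv.swap_apply_right, if_true]; ring
    · rw [Equiv.swap_apply_of_ne_of_ne h2 (hf c (f c₀)), if_neg h2]
      by_cases h3 : blockBase o (f c) = blockBase o (f c₀)
      · rw [h3, Equiv.swap_apply_right, if_pos rfl]; ring
      · rw [Equiv.swap_apply_of_ne_of_ne (fun h => hf c₀ _ h.symm) h3, if_neg h3]; ring
  rw [h, det_mul, det_one_add_replicateCol_mul_replicateRow]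
  simp [hlam]
  ring

/-- By invariance under the swap, the expectation equals its own negative. -/
theorem expect_det_rowDiff_permGram_eq_zero (o : α) {f g : κ → α ⊕ α}
    (hf : ∀ c ρ, f c ≠ blockBase o ρ) (hg : ∀ c ρ, g c ≠ blockBase o ρ)
    {c₀ : κ} (hc : ∀ c, g c ≠ f c₀) :
    𝔼 P : Equiv.Perm α, ((rowDiff o (permGram P)).submatrix f g).det = 0 := by
  obtain ⟨τ₁, τ₂, hτ⟩ := exists_sumCongr_eq_swap_blockBase o (f c₀)
  have h := expect_permGram_submatrix_sumCongr τ₁ τ₂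
    (fun N => ((rowDiff o N).submatrix f g).det)
  simp only [hτ, det_rowDiff_submatrix_swap o _ hf hg hc, Finset.expect_neg_distrib] at h
  linarith

omit [DecidableEq α] in
theorem exists_perm_apply_eq {β : Type*} {i j : β → α} (hi : Function.Injective i)
    (hj : Function.Injective j) : ∃ σ : Equiv.Perm α, ∀ x, σ (i x) = j x := by
  classical
  let e : {x // x ∈ Set.range i} ≃ {x // x ∈ Set.range j} :=
    (Equiv.ofInjective i hi).symm.trans (Equiv.ofInjective j hj)
  refine ⟨e.extendSubtype, fun x => ?_⟩
  rw [Equiv.extendSubtype_apply_of_mem e (i x) ⟨x, rfl⟩]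
  have : (Equiv.ofInjective i hi).symm ⟨i x, ⟨x, rfl⟩⟩ = x :=
    Equiv.ofInjective_symm_apply hi x
  simp [e, this]

omit [DecidableEq α] [Fintype κ] [DecidableEq κ] in
theorem exists_perm_apply_inl (o : α) {h f : κ → α ⊕ α} (hh : Function.Injective h)
    (hf : Function.Injective f) (hh' : ∀ c ρ, h c ≠ blockBase o ρ)
    (hf' : ∀ c ρ, f c ≠ blockBase o ρ) (hs : ∀ c, (h c).isLeft = (f c).isLeft) :
    ∃ τ : Equiv.Perm α, τ o = o ∧ ∀ c a, h c = Sum.inl a → f c = Sum.inl (τ a) := by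
  -- The value `o` at `none` forces the extended permutation to fix the base point, so that
  -- relabelling commutes with `blockBase`.
  let i : Option {c // (h c).isLeft} → α := fun x => x.elim o fun c => (h c).getLeft c.2
  let j : Option {c // (h c).isLeft} → α := fun x => x.elim o fun c =>
    (f c).getLeft (by rw [← hs]; exact c.2)
  have hi : Function.Injective i := by
    rintro (_ | ⟨c, hc⟩) (_ | ⟨d, hd⟩) hcd
    · rfl
    · refine absurd ?_ (hh' d (Sum.inl o))
      rw [← Sum.inl_getLeft _ hd]
      exact congrArg Sum.inl hcd.symm
    · refine absurd ?_ (hh' c (Sum.inl o))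
      rw [← Sum.inl_getLeft _ hc]
      exact congrArg Sum.inl hcd
    · have : h c = h d := by
        rw [← Sum.inl_getLeft _ hc, ← Sum.inl_getLeft _ hd]
        exact congrArg Sum.inl hcd
      have := hh this
      subst this
      rfl
  have hj : Function.Injective j := by
    rintro (_ | ⟨c, hc⟩) (_ | ⟨d, hd⟩) hcd
    · rfl
    · refine absurd ?_ (hf' d (Sum.inl o))
      rw [hs] at hd
      rw [← Sum.inl_getLeft _ hd]
      exact congrArg Sum.inl hcd.symm
    · refine absurd ?_ (hf' c (Sum.inl o))
      rw [hs] at hc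
      rw [← Sum.inl_getLeft _ hc]
      exact congrArg Sum.inl hcd
    · have : f c = f d := by
        rw [hs] at hc hd
        rw [← Sum.inl_getLeft _ hc, ← Sum.inl_getLeft _ hd]
        exact congrArg Sum.inl hcd
      have := hf this
      subst this
      rfl
  obtain ⟨τ, hτ⟩ := exists_perm_apply_eq hi hj
  refine ⟨τ, hτ none, fun c a hca => ?_⟩
  have hc : (h c).isLeft := by simp [hca]
  have h1 := hτ (some ⟨c, hc⟩)
  have h2 : i (some ⟨c, hc⟩) = a := by simp [i, hca]
  rw [h2] at h1
  rw [h1]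
  simp [j]

omit [DecidableEq α] [Fintype κ] [DecidableEq κ] in
theorem exists_perm_apply_inr (o : α) {h f : κ → α ⊕ α} (hh : Function.Injective h)
    (hf : Function.Injective f) (hh' : ∀ c ρ, h c ≠ blockBase o ρ)
    (hf' : ∀ c ρ, f c ≠ blockBase o ρ) (hs : ∀ c, (h c).isLeft = (f c).isLeft) :
    ∃ τ : Equiv.Perm α, τ o = o ∧ ∀ c a, h c = Sum.inr a → f c = Sum.inr (τ a) := by
  have key : ∀ {h : κ → α ⊕ α}, (∀ c ρ, h c ≠ blockBase o ρ) →
      ∀ c ρ, (h c).swap ≠ blockBase o ρ := by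
    intro h hh c ρ e
    refine hh c ρ.swap ?_
    rw [← Sum.swap_swap (h c), e]
    cases ρ <;> rfl
  obtain ⟨τ, h1, h2⟩ := exists_perm_apply_inl o (h := fun c => (h c).swap)
    (f := fun c => (f c).swap) (fun c d e => hh (Sum.swap_leftInverse.injective e))
    (fun c d e => hf (Sum.swap_leftInverse.injective e)) (key hh') (key hf')
    (fun c => by
      rw [Sum.isLeft_swap, Sum.isLeft_swap, ← Sum.bnot_isLeft, ← Sum.bnot_isLeft, hs])
  refine ⟨τ, h1, fun c a hca => ?_⟩
  have := h2 c a (by simp [hca])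
  rw [← Sum.swap_swap (f c), this]
  rfl

/-- The number of indices that a function maps into the second block. -/
def rightCount {ι τ : Type*} (f : κ → ι ⊕ τ) : ℕ := Fintype.card {c // (f c).isRight}

/-- Relabellings that fix the base points act transitively on index sets with a given number of
elements in each block, and they preserve the distribution. -/
theorem expect_det_rowDiff_permGram_congr (o : α) {f g : κ → α ⊕ α} (hfi : Function.Injective f)
    (hgi : Function.Injective g)
    (hf : ∀ c ρ, f c ≠ blockBase o ρ) (hg : ∀ c ρ, g c ≠ blockBase o ρ)
    (hfg : rightCount f = rightCount g) :
    𝔼 P : Equiv.Perm α, ((rowDiff o (permGram P)).submatrix f f).det =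
      𝔼 P : Equiv.Perm α, ((rowDiff o (permGram P)).submatrix g g).det := by
  let e : {c // (g c).isRight} ≃ {c // (f c).isRight} := Fintype.equivOfCardEq hfg.symm
  -- Reordering the positions makes `f ∘ π` and `g` agree on which block each position lies in. A
  -- principal minor does not notice the reordering.
  let π : Equiv.Perm κ := e.extendSubtype
  have hπ : ∀ c, (f (π c)).isRight = (g c).isRight := by
    intro c
    by_cases hc : (g c).isRight
    · rw [hc]; exact e.extendSubtype_mem c hc
    · rw [Bool.eq_iff_iff]
      exact iff_of_false (e.extendSubtype_not_mem c hc) hc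
  have hs : ∀ c, ((f ∘ π) c).isLeft = (g c).isLeft := by
    intro c
    rw [Function.comp_apply, ← Sum.bnot_isRight, ← Sum.bnot_isRight, hπ]
  obtain ⟨τ₁, ho₁, h₁⟩ := exists_perm_apply_inl o (hfi.comp π.injective) hgi
    (fun c ρ => hf (π c) ρ) hg hs
  obtain ⟨τ₂, ho₂, h₂⟩ := exists_perm_apply_inr o (hfi.comp π.injective) hgi
    (fun c ρ => hf (π c) ρ) hg hs
  have hgf : ∀ c, g c = Equiv.sumCongr τ₁ τ₂ (f (π c)) := by
    intro c
    rcases h : f (π c) with a | a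
    · exact h₁ c a h
    · exact h₂ c a h
  rw [← expect_permGram_submatrix_sumCongr τ₁ τ₂
    (fun N => ((rowDiff o N).submatrix f f).det)]
  refine Finset.expect_congr rfl fun P _ => ?_
  rw [← det_submatrix_equiv_self π]
  congr 1
  have hb : ∀ ρ, Equiv.sumCongr τ₁ τ₂ (blockBase o ρ) = blockBase o (Equiv.sumCongr τ₁ τ₂ ρ) := by
    rintro (r | r) <;> simp [blockBase, ho₁, ho₂]
  ext c d
  simp only [rowDiff, submatrix_apply, of_apply, hgf, hb]

theorem det_submatrix_comp_perm {ι τ : Type*} (N : Matrix ι τ ℝ) (f : κ → ι) (g : κ → τ)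
    (π : Equiv.Perm κ) :
    (N.submatrix f (g ∘ π)).det = ((Equiv.Perm.sign π : ℤ) : ℝ) * (N.submatrix f g).det := by
  rw [← det_permute']
  rfl

/-- If the images of `f` and `g` differ, both sides vanish. If they agree, `g` is a reordering of
`f`, which contributes the same sign to both sides and leaves a principal minor. -/
theorem exists_expect_det_rowDiff_permGram (o : α) (κ : Type*) [Fintype κ] [DecidableEq κ] :
    ∃ w : ℕ → ℝ, ∀ f g : κ → α ⊕ α,
      (∀ c ρ, f c ≠ blockBase o ρ) → (∀ c ρ, g c ≠ blockBase o ρ) →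
      𝔼 P : Equiv.Perm α, ((rowDiff o (permGram P)).submatrix f g).det =
        w (rightCount f) * ((1 : Matrix (α ⊕ α) (α ⊕ α) ℝ).submatrix f g).det := by
  classical
  let Q : ℕ → (κ → α ⊕ α) → Prop := fun j f =>
    Function.Injective f ∧ (∀ c ρ, f c ≠ blockBase o ρ) ∧ rightCount f = j
  -- The weight is read off from any admissible injective `f` of the given type. The default `0` is
  -- harmless: without such an `f` both sides vanish.
  refine ⟨fun j => if h : ∃ f, Q j f then
    𝔼 P : Equiv.Perm α, ((rowDiff o (permGram P)).submatrix h.choose h.choose).det else 0,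
    fun f g hf hg => ?_⟩
  by_cases hfi : Function.Injective f
  swap
  · simp [det_submatrix_eq_zero_of_not_injective _ _ hfi]
  by_cases hgi : Function.Injective g
  swap
  · simp [det_submatrix_eq_zero_of_not_injective' _ _ hgi]
  by_cases hsub : ∃ c₀, ∀ c, g c ≠ f c₀
  · obtain ⟨c₀, hc⟩ := hsub
    rw [expect_det_rowDiff_permGram_eq_zero o hf hg hc, det_eq_zero_of_row_eq_zero c₀, mul_zero]
    intro d
    simp [(hc d).symm]
  push Not at hsub
  choose π hπ using hsub
  have hπi : Function.Injective π := fun c d h => hfi (by rw [← hπ c, ← hπ d, h])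
  let π' : Equiv.Perm κ := Equiv.ofBijective π (Finite.injective_iff_bijective.mp hπi)
  have hg' : g = f ∘ π'.symm := by
    ext1 c
    have := hπ (π'.symm c)
    rw [Function.comp_apply, ← this]
    congr 1
    exact (π'.apply_symm_apply c).symm
  have hQ : ∃ f', Q (rightCount f) f' := ⟨f, hfi, hf, rfl⟩
  obtain ⟨h1, h2, h3⟩ := hQ.choose_spec
  rw [hg']
  simp only [det_submatrix_comp_perm, dif_pos hQ]
  rw [expect_det_rowDiff_permGram_congr o h1 hfi h2 hf h3, ← Finset.mul_expect,
    submatrix_one f hfi, det_one]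
  ring

/-- Each column of `V` lives in one block, so all nonzero terms of the expansion have the same
`rightCount f`. The weight then factors out, and the remaining sum is the same expansion for the
identity matrix. -/
theorem exists_expect_det_transpose_mul_permGram_mul [Nonempty α] (κ : Type*) [Fintype κ]
    [DecidableEq κ] :
    ∃ w : ℕ → ℝ, ∀ (V V' : Matrix (α ⊕ α) κ ℝ) (s : κ → Bool),
      (∀ c, ∑ r, V (Sum.inl r) c = 0) → (∀ c, ∑ r, V (Sum.inr r) c = 0) →
      (∀ ρ c, V ρ c ≠ 0 → ρ.isRight = s c) →
      𝔼 P : Equiv.Perm α, (Vᵀ * permGram P * V').det =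
        w (Fintype.card {c // s c}) * (Vᵀ * V').det := by
  let o : α := Classical.arbitrary α
  obtain ⟨w, hw⟩ := exists_expect_det_rowDiff_permGram o κ
  refine ⟨w, fun V V' s h₁ h₂ hs => ?_⟩
  have hone : Vᵀ * V' = Vᵀ * (1 : Matrix (α ⊕ α) (α ⊕ α) ℝ) * V' := by rw [Matrix.mul_one]
  rw [hone, det_transpose_mul_mul_eq_sum o 1 V V' h₁ h₂ (sum_rowDiff_one_inl o)
    (sum_rowDiff_one_inr o)]
  simp only [det_transpose_mul_mul_eq_sum o (permGram _) V V' h₁ h₂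
    (sum_rowDiff_permGram_inl o _) (sum_rowDiff_permGram_inr o _)]
  rw [Finset.expect_sum_comm, Finset.mul_sum]
  refine Finset.sum_congr rfl fun f _ => ?_
  rw [Finset.expect_sum_comm, Finset.mul_sum]
  refine Finset.sum_congr rfl fun g _ => ?_
  rw [← Finset.mul_expect]
  by_cases hf : ∀ c ρ, f c ≠ blockBase o ρ
  swap
  · push Not at hf
    obtain ⟨c, ρ, hc⟩ := hf
    have : ∀ N : Matrix (α ⊕ α) (α ⊕ α) ℝ, ((rowDiff o N).submatrix f g).det = 0 := fun N =>
      det_eq_zero_of_row_eq_zero c fun d => by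
        rw [submatrix_apply, hc, rowDiff_blockBase]
    simp [this]
  by_cases hg : ∀ c ρ, g c ≠ blockBase o ρ
  swap
  · push Not at hg
    obtain ⟨c, ρ, hc⟩ := hg
    have : ∏ c, rowDiff o V' (g c) c = 0 := Finset.prod_eq_zero (Finset.mem_univ c) (by
      rw [hc, rowDiff_blockBase])
    simp [this]
  by_cases hV : ∏ c, V (f c) c = 0
  · simp [hV]
  have hfs : rightCount f = Fintype.card {c // s c} := by
    have : ∀ c, (f c).isRight = s c := fun c =>
      hs _ _ (Finset.prod_ne_zero_iff.mp hV c (Finset.mem_univ c))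
    simp only [rightCount, this]
  have hsub : (rowDiff o (1 : Matrix (α ⊕ α) (α ⊕ α) ℝ)).submatrix f g =
      (1 : Matrix (α ⊕ α) (α ⊕ α) ℝ).submatrix f g := by
    ext c d
    simp [rowDiff, one_apply, (hg d (f c)).symm]
  rw [hw f g hf hg, hfs, hsub]
  ring

end PermGram

end Matrix

theorem Polynomial.eq_of_forall_sum_mul_pow_eq {k : ℕ} {a b : ℕ → ℝ}
    (h : ∀ y : ℝ, ∑ j ∈ Finset.range (k + 1), a j * y ^ j =
      ∑ j ∈ Finset.range (k + 1), b j * y ^ j) {j : ℕ} (hj : j ≤ k) : a j = b j := by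
  have h1 : ∑ j ∈ Finset.range (k + 1), C (a j) * X ^ j =
      ∑ j ∈ Finset.range (k + 1), C (b j) * X ^ j := by
    refine Polynomial.funext fun y => ?_
    simpa [eval_finsetSum] using h y
  have h2 := congrArg (fun p => p.coeff j) h1
  simpa [finsetSum_coeff, coeff_C_mul, coeff_X_pow, Nat.lt_succ_iff, hj] using h2

namespace Matrix

/-! ### Sorting minors by the number of indices in the second block. -/

section RightCount

variable {ι τ : Type*} [Fintype ι] [DecidableEq ι] [Fintype τ] [DecidableEq τ]

/-- The diagonal matrix that scales the second block by `y`. -/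
def blockScale (ι τ : Type*) [DecidableEq ι] [DecidableEq τ] (y : ℝ) :
    Matrix (ι ⊕ τ) (ι ⊕ τ) ℝ :=
  diagonal (Sum.elim (fun _ => 1) (fun _ => y))

theorem minorSum_blockScale_mul (k : ℕ) (y : ℝ) (N : Matrix (ι ⊕ τ) (ι ⊕ τ) ℝ) :
    minorSum k (blockScale ι τ y * N) =
      ∑ f : Fin k → ι ⊕ τ, y ^ rightCount f * (N.submatrix f f).det := by
  refine Finset.sum_congr rfl fun f _ => ?_
  have h : (blockScale ι τ y * N).submatrix f f =
      of fun c d => (if (f c).isRight then y else 1) * N.submatrix f f c d := by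
    ext c d
    simp only [submatrix_apply, blockScale, diagonal_mul, of_apply]
    congr 1
    rcases f c with a | a <;> simp
  rw [h, det_mul_column, Finset.prod_ite, Finset.prod_const, Finset.prod_const_one, mul_one,
    rightCount, Fintype.card_subtype]

theorem rightCount_le {k : ℕ} {ι τ : Type*} (f : Fin k → ι ⊕ τ) : rightCount f ≤ k := by
  simpa [rightCount] using Fintype.card_subtype_le fun c => (f c).isRight = true

omit [DecidableEq ι] [DecidableEq τ] in
theorem sum_eq_sum_range_rightCount (k : ℕ) (F : (Fin k → ι ⊕ τ) → ℝ) :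
    ∑ f, F f = ∑ j ∈ Finset.range (k + 1), ∑ f with rightCount f = j, F f :=
  (Finset.sum_fiberwise_of_maps_to
    (fun f _ => Finset.mem_range.mpr (Nat.lt_succ_of_le (rightCount_le f))) F).symm

/-- Scaling the second block by `y` marks each minor with `y ^ rightCount f`; comparing coefficients
of `y` isolates each type, which can then be weighted arbitrarily. -/
theorem sum_rightCount_mul_det_fromBlocks (k : ℕ) (c : ℕ → ℝ) (G : Matrix ι ι ℝ)
    (H : Matrix τ τ ℝ) :
    ∑ f : Fin k → ι ⊕ τ, c (rightCount f) * ((fromBlocks G 0 0 H).submatrix f f).det =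
      ∑ j ∈ Finset.range (k + 1),
        c j * ((k.choose j : ℝ) * minorSum (k - j) G * minorSum j H) := by
  have hfib : ∀ ψ : ℕ → ℝ,
      ∑ f : Fin k → ι ⊕ τ, ψ (rightCount f) * ((fromBlocks G 0 0 H).submatrix f f).det =
        ∑ j ∈ Finset.range (k + 1), ψ j *
          ∑ f : Fin k → ι ⊕ τ with rightCount f = j,
            ((fromBlocks G 0 0 H).submatrix f f).det := by
    intro ψ
    rw [sum_eq_sum_range_rightCount]
    refine Finset.sum_congr rfl fun j _ => ?_
    rw [Finset.mul_sum]
    refine Finset.sum_congr rfl fun f hf => ?_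
    rw [(Finset.mem_filter.mp hf).2]
  have hy : ∀ y : ℝ, ∑ j ∈ Finset.range (k + 1),
      (∑ f : Fin k → ι ⊕ τ with rightCount f = j,
        ((fromBlocks G 0 0 H).submatrix f f).det) * y ^ j =
      ∑ j ∈ Finset.range (k + 1),
        ((k.choose j : ℝ) * minorSum (k - j) G * minorSum j H) * y ^ j := by
    intro y
    have h1 : blockScale ι τ y * fromBlocks G 0 0 H = fromBlocks G 0 0 (y • H) := by
      ext (i | i) (j | j) <;> simp [blockScale]
    have h2 := minorSum_blockScale_mul k y (fromBlocks G 0 0 H)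
    rw [h1, minorSum_fromBlocks, hfib (fun j => y ^ j)] at h2
    simp only [mul_comm _ (y ^ _), ← h2, minorSum_smul]
    refine Finset.sum_congr rfl fun j _ => ?_
    ring
  rw [hfib]
  refine Finset.sum_congr rfl fun j hj => ?_
  rw [eq_of_forall_sum_mul_pow_eq hy (Nat.lt_succ_iff.mp (Finset.mem_range.mp hj))]

end RightCount

/-! ### Rank one updates and the projection onto sum zero. -/

section Centering

variable {α : Type*} [Fintype α] [DecidableEq α]

/-- If `N u = 0`, a rank one update `N + u vᵀ` moves one eigenvalue `0` of `N` to `v ⬝ᵥ u`. -/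
theorem charpoly_add_vecMulVec_mul_X [Nonempty α] (N : Matrix α α ℝ) (u v : α → ℝ)
    (h : N *ᵥ u = 0) :
    (N + vecMulVec u v).charpoly * X = (X - C (u ⬝ᵥ v)) * N.charpoly := by
  -- In `(X - N)(X - u vᵀ)` the product `N u vᵀ` vanishes, which leaves `X (X - N - u vᵀ)`.
  have hmul : charmatrix N * charmatrix (vecMulVec u v) =
      (X : ℝ[X]) • charmatrix (N + vecMulVec u v) := by
    have h0 : N * vecMulVec u v = 0 := by
      rw [mul_vecMulVec, h]
      ext
      simp [vecMulVec_apply]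
    have h1 : N.map C * (vecMulVec u v).map C = (0 : Matrix α α ℝ[X]) := by
      rw [← Matrix.map_mul, h0]
      ext
      simp
    have h2 : ∀ L : Matrix α α ℝ, charmatrix L = (X : ℝ[X]) • (1 : Matrix α α ℝ[X]) - L.map C := by
      intro L
      rw [charmatrix, scalar_apply, smul_one_eq_diagonal]
      rfl
    have h3 : (N + vecMulVec u v).map C = N.map C + (vecMulVec u v).map C :=
      Matrix.map_add _ (fun _ _ => C_add) _ _
    rw [h2, h2, h2, h3, sub_mul, mul_sub, mul_sub, h1]
    simp only [smul_mul_assoc, one_mul, mul_smul_comm, mul_one, smul_sub, smul_add]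
    abel
  have hdet := congrArg det hmul
  rw [det_mul, det_smul] at hdet
  change N.charpoly * (vecMulVec u v).charpoly = _ * (N + vecMulVec u v).charpoly at hdet
  have hc : (X : ℝ[X]) ^ Fintype.card α = X ^ (Fintype.card α - 1) * X := by
    rw [← pow_succ, Nat.sub_add_cancel Fintype.card_pos]
  rw [charpoly_vecMulVec, hc, smul_eq_C_mul] at hdet
  apply mul_left_cancel₀ (pow_ne_zero (Fintype.card α - 1) (X_ne_zero (R := ℝ)))
  linear_combination -hdet

/-- The orthogonal projection onto the vectors with coordinate sum `0`. -/
noncomputable def centering (α : Type*) [Fintype α] [DecidableEq α] : Matrix α α ℝ :=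
  1 - of fun _ _ => (Fintype.card α : ℝ)⁻¹

theorem mul_centering {σ : Type*} (N : Matrix σ α ℝ) (h : ∀ x, ∑ r, N x r = 0) :
    N * centering α = N := by
  ext x r
  rw [centering, Matrix.mul_sub, Matrix.mul_one, sub_apply, mul_apply]
  simp [← Finset.sum_mul, h]

theorem transpose_centering : (centering α)ᵀ = centering α := by
  ext r s
  simp [centering, one_apply, eq_comm]

theorem sum_centering [Nonempty α] (r : α) : ∑ s, centering α r s = 0 := by
  simp [centering, one_apply]

theorem sum_centering' [Nonempty α] (s : α) : ∑ r, centering α r s = 0 := by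
  rw [← transpose_centering]
  exact sum_centering s

theorem centering_mul_centering [Nonempty α] : centering α * centering α = centering α :=
  mul_centering _ sum_centering

theorem permMatrix_mul_centering_mul_transpose (P : Equiv.Perm α) :
    P.permMatrix ℝ * centering α * (P.permMatrix ℝ)ᵀ = centering α := by
  rw [transpose_permMatrix, PEquiv.toMatrix_toPEquiv_mul, PEquiv.mul_toMatrix_toPEquiv]
  ext r s
  have h : P r = P⁻¹.symm s ↔ r = s := P.injective.eq_iff
  simp only [centering, submatrix_apply, id_eq, sub_apply, one_apply, h, of_apply]

/-- The identity is a rank one update of the projection along its kernel, so the update formula can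
be read backwards. -/
theorem charpoly_centering [Nonempty α] :
    (centering α).charpoly = X * (X - C 1) ^ (Fintype.card α - 1) := by
  have h := charpoly_add_vecMulVec_mul_X (centering α) (fun _ => 1)
    (fun _ => (Fintype.card α : ℝ)⁻¹) (by
      ext r
      simp [mulVec, dotProduct, sum_centering])
  have h1 : centering α + vecMulVec (fun _ => 1) (fun _ => (Fintype.card α : ℝ)⁻¹) = 1 := by
    ext r s
    simp [centering, vecMulVec_apply]
  have h2 : (fun _ : α => (1 : ℝ)) ⬝ᵥ (fun _ => (Fintype.card α : ℝ)⁻¹) = 1 := by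
    simp [dotProduct]
  rw [h1, h2, charpoly_one] at h
  have h3 : (X - C (1 : ℝ)) ≠ 0 := X_sub_C_ne_zero 1
  apply mul_left_cancel₀ h3
  have hc : (X - C 1 : ℝ[X]) ^ Fintype.card α =
      (X - C 1) ^ (Fintype.card α - 1) * (X - C 1) := by
    rw [← pow_succ, Nat.sub_add_cancel Fintype.card_pos]
  rw [← h]
  rw [C_1] at hc ⊢
  rw [hc]
  ring

theorem minorSum_centering [Nonempty α] {k : ℕ} (hk : k < Fintype.card α) :
    minorSum k (centering α) = ((Fintype.card α - 1).descFactorial k : ℝ) := by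
  have h := factorial_mul_charpoly_coeff (centering α) hk.le
  have h1 : Fintype.card α - k = (Fintype.card α - 1 - k) + 1 := by omega
  have h2 : Fintype.card α - 1 - (Fintype.card α - 1 - k) = k := by omega
  rw [h1, charpoly_centering, coeff_X_mul, sub_eq_add_neg X, ← C_neg, coeff_X_add_C_pow, h2,
    Nat.choose_symm (by omega)] at h
  rw [Nat.descFactorial_eq_factorial_mul_choose]
  have h3 : ((-1 : ℝ) ^ k) ≠ 0 := pow_ne_zero _ (by norm_num)
  apply mul_left_cancel₀ h3
  rw [← h]
  push_cast
  ring

end Centering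

/-! ### Expected Gram minors and the expected minor sums of `MᵀM`. -/

section Gram

variable {α : Type} [Fintype α] [DecidableEq α]

/-- The ratio between the expected minor of the Gram matrix of the columns of `[U | P V]` and the
minor of the Gram matrix of the columns of `U ⊕ V`. -/
noncomputable def gramWeight (m k j : ℕ) : ℝ :=
  ((m - 1).descFactorial k : ℝ) / ((m - 1).descFactorial (k - j) * (m - 1).descFactorial j)

theorem transpose_fromCols_mul_fromCols {ι : Type*} (P : Equiv.Perm α) (U V : Matrix α ι ℝ) :
    (fromCols U (P.permMatrix ℝ * V))ᵀ * fromCols U (P.permMatrix ℝ * V) =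
      (fromBlocks U 0 0 V)ᵀ * permGram P * fromBlocks U 0 0 V := by
  have hP : (P.permMatrix ℝ)ᵀ * P.permMatrix ℝ = 1 := by
    rw [transpose_permMatrix, ← permMatrix_mul, mul_inv_cancel, permMatrix_one]
  have h : Vᵀ * (P.permMatrix ℝ)ᵀ * (P.permMatrix ℝ * V) = Vᵀ * V := by
    rw [Matrix.mul_assoc, ← Matrix.mul_assoc _ _ V, hP, Matrix.one_mul]
  rw [transpose_fromCols, fromRows_mul_fromCols, fromBlocks_transpose, permGram,
    fromBlocks_multiply, fromBlocks_multiply]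
  rw [transpose_mul, h, ← Matrix.mul_assoc]
  simp [-transpose_permMatrix]

theorem exists_expect_det_gram_submatrix [Nonempty α] (k : ℕ) :
    ∃ w : ℕ → ℝ, ∀ {ι : Type} [Fintype ι] (U V : Matrix α ι ℝ),
      (∀ i, ∑ r, U r i = 0) → (∀ i, ∑ r, V r i = 0) → ∀ f g : Fin k → ι ⊕ ι,
      𝔼 P : Equiv.Perm α, (((fromCols U (P.permMatrix ℝ * V))ᵀ *
          fromCols U (P.permMatrix ℝ * V)).submatrix f g).det =
        w (rightCount f) * ((fromBlocks (Uᵀ * U) 0 0 (Vᵀ * V)).submatrix f g).det := by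
  obtain ⟨w, hw⟩ := exists_expect_det_transpose_mul_permGram_mul (α := α) (Fin k)
  refine ⟨w, fun {ι} _ U V hU hV f g => ?_⟩
  have h := hw ((fromBlocks U 0 0 V).submatrix id f) ((fromBlocks U 0 0 V).submatrix id g)
    (fun c => (f c).isRight)
    (fun c => by simp only [submatrix_apply, id]; rcases f c with i | i <;> simp [hU])
    (fun c => by simp only [submatrix_apply, id]; rcases f c with i | i <;> simp [hV])
    (fun ρ c => by
      simp only [submatrix_apply, id]
      rcases f c with i | i <;> rcases ρ with r | r <;> simp)
  have h1 : fromBlocks (Uᵀ * U) 0 0 (Vᵀ * V) = (fromBlocks U 0 0 V)ᵀ * fromBlocks U 0 0 V := by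
    rw [fromBlocks_transpose, fromBlocks_multiply]
    simp
  simp only [transpose_fromCols_mul_fromCols, h1]
  exact h

/-- The nonzero spectrum is that of `J + y P J Pᵀ`, and `J` commutes with permutations, so this is
`(1 + y) J` for every `P`. -/
theorem minorSum_blockScale_mul_gram_centering [Nonempty α] (k : ℕ) (y : ℝ)
    (P : Equiv.Perm α) :
    minorSum k (blockScale α α y * ((fromCols (centering α) (P.permMatrix ℝ * centering α))ᵀ *
      fromCols (centering α) (P.permMatrix ℝ * centering α))) =
      (y + 1) ^ k * minorSum k (centering α) := by
  rw [← Matrix.mul_assoc, minorSum_mul_comm, ← minorSum_smul]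
  congr 1
  have h1 : blockScale α α y * (fromCols (centering α) (P.permMatrix ℝ * centering α))ᵀ =
      fromRows (centering α) (y • (centering α * (P.permMatrix ℝ)ᵀ)) := by
    rw [transpose_fromCols, transpose_mul, transpose_centering]
    ext (r | r) s <;> simp [blockScale, -transpose_permMatrix]
  have h2 : P.permMatrix ℝ * centering α * (centering α * (P.permMatrix ℝ)ᵀ) = centering α := by
    rw [Matrix.mul_assoc, ← Matrix.mul_assoc (centering α), centering_mul_centering,
      ← Matrix.mul_assoc, permMatrix_mul_centering_mul_transpose]
  rw [h1, fromCols_mul_fromRows, Matrix.mul_smul, h2, centering_mul_centering, add_smul, one_smul,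
    add_comm]

/-- The weight does not depend on `U` and `V`, so it can be computed for `U = V = J`, where the
generating function in `y` of the expected principal minors is known. -/
theorem expect_det_gram_submatrix {k : ℕ} (hk : k < Fintype.card α) {ι : Type} [Fintype ι]
    (U V : Matrix α ι ℝ) (hU : ∀ i, ∑ r, U r i = 0) (hV : ∀ i, ∑ r, V r i = 0)
    (f g : Fin k → ι ⊕ ι) :
    𝔼 P : Equiv.Perm α, (((fromCols U (P.permMatrix ℝ * V))ᵀ *
          fromCols U (P.permMatrix ℝ * V)).submatrix f g).det =
      gramWeight (Fintype.card α) k (rightCount f) *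
        ((fromBlocks (Uᵀ * U) 0 0 (Vᵀ * V)).submatrix f g).det := by
  have : Nonempty α := Fintype.card_pos_iff.mp (by omega)
  obtain ⟨w, hw⟩ := exists_expect_det_gram_submatrix (α := α) k
  rw [hw U V hU hV]
  congr 1
  have key : ∀ y : ℝ, ∑ j ∈ Finset.range (k + 1), (w j * ((k.choose j : ℝ) *
      minorSum (k - j) (centering α) * minorSum j (centering α))) * y ^ j =
      ∑ j ∈ Finset.range (k + 1), ((k.choose j : ℝ) * minorSum k (centering α)) * y ^ j := by
    intro y
    calc _ = ∑ j ∈ Finset.range (k + 1), (y ^ j * w j) * ((k.choose j : ℝ) *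
          minorSum (k - j) (centering α) * minorSum j (centering α)) :=
          Finset.sum_congr rfl fun j _ => by ring
      _ = ∑ f : Fin k → α ⊕ α, (y ^ rightCount f * w (rightCount f)) *
          ((fromBlocks (centering α) 0 0 (centering α)).submatrix f f).det :=
          (sum_rightCount_mul_det_fromBlocks k (fun j => y ^ j * w j) _ _).symm
      _ = ∑ f : Fin k → α ⊕ α, 𝔼 P : Equiv.Perm α, y ^ rightCount f *
          (((fromCols (centering α) (P.permMatrix ℝ * centering α))ᵀ *
            fromCols (centering α) (P.permMatrix ℝ * centering α)).submatrix f f).det := by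
          refine Finset.sum_congr rfl fun f _ => ?_
          rw [← Finset.mul_expect, hw _ _ sum_centering' sum_centering', transpose_centering,
            centering_mul_centering, mul_assoc]
      _ = (y + 1) ^ k * minorSum k (centering α) := by
          rw [← Finset.expect_sum_comm]
          simp only [← minorSum_blockScale_mul, minorSum_blockScale_mul_gram_centering,
            Fintype.expect_const]
      _ = _ := by
          rw [add_pow, Finset.sum_mul]
          refine Finset.sum_congr rfl fun j _ => ?_
          rw [one_pow]
          ring
  have hj : rightCount f ≤ k := rightCount_le f
  have h := Polynomial.eq_of_forall_sum_mul_pow_eq key hj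
  -- The projection has rank `card α - 1`, so the bound `k < card α` keeps its minor sums nonzero
  -- and the weight determined.
  have hne : ∀ i ≤ k, ((Fintype.card α - 1).descFactorial i : ℝ) ≠ 0 := fun i hi =>
    Nat.cast_ne_zero.mpr fun h0 => by
      rw [Nat.descFactorial_eq_zero_iff_lt] at h0
      omega
  have hch : ((k.choose (rightCount f) : ℕ) : ℝ) ≠ 0 :=
    Nat.cast_ne_zero.mpr (Nat.choose_pos hj).ne'
  rw [minorSum_centering hk, minorSum_centering (by omega), minorSum_centering (by omega)] at h
  rw [gramWeight, eq_div_iff (mul_ne_zero (hne _ (Nat.sub_le _ _)) (hne _ hj))]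
  apply mul_left_cancel₀ hch
  linear_combination h

/-- Inserting the projection `J` as right factor separates `P` from `S`. Both Gram matrices then
satisfy `expect_det_gram_submatrix`, with weights depending on the same index function `f`. -/
theorem expect_minorSum_transpose_mul {β : Type} [Fintype β] [DecidableEq β] {k : ℕ}
    (hk : k < Fintype.card α) (hk' : k < Fintype.card β) (A B : Matrix α β ℝ)
    (hA : ∀ r, ∑ s, A r s = 0) (hA' : ∀ s, ∑ r, A r s = 0)
    (hB : ∀ r, ∑ s, B r s = 0) (hB' : ∀ s, ∑ r, B r s = 0) :
    𝔼 P : Equiv.Perm α, 𝔼 S : Equiv.Perm β,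
      minorSum k ((A + P.permMatrix ℝ * B * (S.permMatrix ℝ)ᵀ)ᵀ *
        (A + P.permMatrix ℝ * B * (S.permMatrix ℝ)ᵀ)) =
      ∑ j ∈ Finset.range (k + 1),
        gramWeight (Fintype.card α) k j * gramWeight (Fintype.card β) k j *
          ((k.choose j : ℝ) * minorSum (k - j) (Aᵀ * A) * minorSum j (Bᵀ * B)) := by
  have : Nonempty β := Fintype.card_pos_iff.mp (by omega)
  set G : Equiv.Perm α → Matrix (β ⊕ β) (β ⊕ β) ℝ := fun P =>
    (fromCols A (P.permMatrix ℝ * B))ᵀ * fromCols A (P.permMatrix ℝ * B) with hG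
  set H : Equiv.Perm β → Matrix (β ⊕ β) (β ⊕ β) ℝ := fun S =>
    (fromCols (centering β) (S.permMatrix ℝ * centering β))ᵀ *
      fromCols (centering β) (S.permMatrix ℝ * centering β) with hH
  have hk0 : (k ! : ℝ) ≠ 0 := Nat.cast_ne_zero.mpr (Nat.factorial_ne_zero k)
  have hGH : ∀ P S, (k ! : ℝ) * minorSum k ((A + P.permMatrix ℝ * B * (S.permMatrix ℝ)ᵀ)ᵀ *
        (A + P.permMatrix ℝ * B * (S.permMatrix ℝ)ᵀ)) =
      ∑ f : Fin k → β ⊕ β, ∑ g : Fin k → β ⊕ β,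
        ((G P).submatrix f g).det * ((H S).submatrix f g).det := by
    intro P S
    have h1 : A + P.permMatrix ℝ * B * (S.permMatrix ℝ)ᵀ = fromCols A (P.permMatrix ℝ * B) *
        (fromCols (centering β) (S.permMatrix ℝ * centering β))ᵀ := by
      rw [transpose_fromCols, fromCols_mul_fromRows, transpose_mul, transpose_centering,
        mul_centering A hA, ← Matrix.mul_assoc, Matrix.mul_assoc _ B (centering β),
        mul_centering B hB]
    have h2 : (A + P.permMatrix ℝ * B * (S.permMatrix ℝ)ᵀ)ᵀ *
        (A + P.permMatrix ℝ * B * (S.permMatrix ℝ)ᵀ) =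
        fromCols (centering β) (S.permMatrix ℝ * centering β) *
          (G P * (fromCols (centering β) (S.permMatrix ℝ * centering β))ᵀ) := by
      rw [h1, transpose_mul, transpose_transpose, hG]
      simp only [Matrix.mul_assoc]
    have h3 : ∀ f g : Fin k → β ⊕ β,
        ((H S).submatrix g f).det = ((H S).submatrix f g).det := by
      intro f g
      rw [← det_transpose, transpose_submatrix, hH, transpose_mul, transpose_transpose]
    rw [h2, minorSum_mul_comm, Matrix.mul_assoc, factorial_mul_minorSum_mul]
    refine Finset.sum_congr rfl fun f _ => Finset.sum_congr rfl fun g _ => ?_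
    rw [← h3 f g]
  apply mul_left_cancel₀ hk0
  rw [Finset.mul_expect]
  simp only [Finset.mul_expect, hGH]
  have hexp : 𝔼 P : Equiv.Perm α, 𝔼 S : Equiv.Perm β,
      ∑ f : Fin k → β ⊕ β, ∑ g : Fin k → β ⊕ β,
        ((G P).submatrix f g).det * ((H S).submatrix f g).det =
      ∑ f : Fin k → β ⊕ β, ∑ g : Fin k → β ⊕ β,
        (𝔼 P : Equiv.Perm α, ((G P).submatrix f g).det) *
          𝔼 S : Equiv.Perm β, ((H S).submatrix f g).det := by
    simp only [Finset.expect_sum_comm, ← Finset.mul_expect, ← Finset.expect_mul]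
  rw [hexp]
  simp only [hG, hH, expect_det_gram_submatrix hk A B hA' hB',
    expect_det_gram_submatrix hk' (centering β) (centering β) sum_centering' sum_centering',
    transpose_centering, centering_mul_centering]
  -- The weights depend on `f` alone, so Cauchy–Binet can be undone in the sum over `g`, and `J` is
  -- absorbed by the zero row sums.
  have hZ : fromBlocks (Aᵀ * A) 0 0 (Bᵀ * B) * fromBlocks (centering β) 0 0 (centering β) =
      fromBlocks (Aᵀ * A) 0 0 (Bᵀ * B) := by
    rw [fromBlocks_multiply]
    simp only [Matrix.mul_assoc, mul_centering A hA, mul_centering B hB, Matrix.mul_zero,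
      Matrix.zero_mul, add_zero, zero_add]
  have hsymm : ∀ f g : Fin k → β ⊕ β,
      ((fromBlocks (centering β) 0 0 (centering β)).submatrix f g).det =
        ((fromBlocks (centering β) 0 0 (centering β)).submatrix g f).det := by
    intro f g
    rw [← det_transpose, transpose_submatrix, fromBlocks_transpose, transpose_centering,
      transpose_zero]
  rw [← sum_rightCount_mul_det_fromBlocks k (fun j => gramWeight (Fintype.card α) k j *
    gramWeight (Fintype.card β) k j), Finset.mul_sum]
  refine Finset.sum_congr rfl fun f _ => ?_
  have hcb := factorial_card_mul_det_mul
    ((fromBlocks (Aᵀ * A) 0 0 (Bᵀ * B)).submatrix f id)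
    ((fromBlocks (centering β) 0 0 (centering β)).submatrix id f)
  rw [Fintype.card_fin, ← submatrix_mul _ _ f id f Function.bijective_id, hZ] at hcb
  rw [mul_left_comm, hcb, Finset.mul_sum]
  refine Finset.sum_congr rfl fun g _ => ?_
  rw [hsymm f g]
  simp only [submatrix_submatrix, Function.comp_id, Function.id_comp]
  ring

end Gram

end Matrix

namespace Matrix

/-! ### Removing a singular value, and bipartite characteristic polynomials. -/

theorem X_sub_C_dvd_charpoly {α : Type*} [Fintype α] [DecidableEq α] {N : Matrix α α ℝ}
    {u : α → ℝ} {c : ℝ} (hu : u ≠ 0) (h : N *ᵥ u = c • u) : (X - C c) ∣ N.charpoly := by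
  rw [dvd_iff_isRoot, IsRoot, eval_charpoly]
  refine exists_mulVec_eq_zero_iff.mp ⟨u, hu, ?_⟩
  rw [sub_mulVec, h, scalar_apply, ← smul_one_eq_diagonal, smul_mulVec, one_mulVec, sub_self]

section Deflation

variable {α β : Type*} [Fintype α] [Fintype β] [DecidableEq β]

/-- With `D = M - c v uᵀ` one has `D u = 0` and `MᵀM = DᵀD + c² u uᵀ`, a rank one update along the
kernel. -/
theorem charpoly_transpose_mul_self_mul_X [Nonempty β] (M : Matrix α β ℝ) {u : β → ℝ}
    {v : α → ℝ} {c : ℝ} (hu : u ⬝ᵥ u = 1) (hv : v ⬝ᵥ v = 1) (h : M *ᵥ u = c • v)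
    (h' : Mᵀ *ᵥ v = c • u) :
    (Mᵀ * M).charpoly * X = (X - C (c ^ 2)) *
      ((M - c • vecMulVec v u)ᵀ * (M - c • vecMulVec v u)).charpoly := by
  have h0 : (M - c • vecMulVec v u) *ᵥ u = 0 := by
    rw [sub_mulVec, h, smul_mulVec, vecMulVec_mulVec, hu]
    simp
  have h1 : Mᵀ * M = (M - c • vecMulVec v u)ᵀ * (M - c • vecMulVec v u) +
      vecMulVec u (c ^ 2 • u) := by
    have h2 : Mᵀ * vecMulVec v u = c • vecMulVec u u := by
      rw [mul_vecMulVec, h', smul_vecMulVec]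
    have h3 : vecMulVec u v * M = c • vecMulVec u u := by
      rw [vecMulVec_mul, ← mulVec_transpose, h', vecMulVec_smul]
    have h4 : vecMulVec u v * vecMulVec v u = vecMulVec u u := by
      rw [vecMulVec_mul_vecMulVec, hv, one_smul]
    rw [transpose_sub, transpose_smul, transpose_vecMulVec, Matrix.sub_mul, Matrix.mul_sub,
      Matrix.mul_sub]
    simp only [Matrix.smul_mul, Matrix.mul_smul, h2, h3, h4, vecMulVec_smul, smul_smul]
    rw [pow_two]
    abel
  rw [h1, charpoly_add_vecMulVec_mul_X _ _ _ (by rw [← mulVec_mulVec, h0, mulVec_zero])]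
  rw [dotProduct_smul, hu, smul_eq_mul, mul_one]

end Deflation

theorem charpoly_fromBlocks_zero_transpose {α β : Type*} [Fintype α] [DecidableEq α]
    [Fintype β] [DecidableEq β] (M : Matrix α β ℝ) (h : Fintype.card β ≤ Fintype.card α) :
    (fromBlocks 0 M Mᵀ 0).charpoly =
      X ^ (Fintype.card α - Fintype.card β) * (Mᵀ * M).charpoly.comp (X ^ 2) := by
  -- Column elimination without division: the multiplier has determinant `X ^ card β`, which is
  -- cancelled at the end.
  have h1 : charmatrix (fromBlocks 0 M Mᵀ 0) * fromBlocks 1 (M.map C) 0 (scalar β X) =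
      fromBlocks (scalar α X) 0 (-Mᵀ.map C) (scalar β (X ^ 2) - (Mᵀ * M).map C) := by
    rw [charmatrix_fromBlocks, fromBlocks_multiply]
    congr 1
    · simp [charmatrix]
    · have h0 : charmatrix (0 : Matrix α α ℝ) = scalar α X := by simp [charmatrix]
      ext1 i j
      simp only [h0, scalar_apply, add_apply, diagonal_mul, Matrix.neg_mul, neg_apply,
        mul_diagonal, zero_apply]
      ring
    · simp
    · rw [Matrix.map_mul]
      simp only [charmatrix, RingHom.mapMatrix_apply, Matrix.map_zero, C_0, sub_zero, pow_two, map_mul]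
      rw [Matrix.neg_mul, neg_add_eq_sub]
  have h2 : (scalar β (X ^ 2) - (Mᵀ * M).map C).det = (Mᵀ * M).charpoly.comp (X ^ 2) := by
    rw [charpoly, ← coe_compRingHom_apply, RingHom.map_det]
    congr 1
    ext1 i j
    by_cases hij : i = j
    · simp [hij, -Matrix.map_mul]
    · simp [hij, -Matrix.map_mul]
  have h3 := congrArg det h1
  rw [det_mul, det_fromBlocks_zero₁₂, det_fromBlocks_zero₂₁, h2] at h3
  simp only [scalar_apply, det_diagonal, Finset.prod_const, Finset.card_univ, det_one,
    one_mul] at h3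
  change (fromBlocks 0 M Mᵀ 0).charpoly * _ = _ at h3
  apply mul_right_cancel₀ (pow_ne_zero (Fintype.card β) (X_ne_zero (R := ℝ)))
  rw [h3, mul_right_comm, ← pow_add, Nat.sub_add_cancel h]

theorem gramWeight_eq {m k j : ℕ} (hk : k ≤ m - 1) (hj : j ≤ k) :
    gramWeight m k j = (((m - 1 - (k - j))! : ℝ) * ((m - 1 - j)! : ℝ)) /
      (((m - 1)! : ℝ) * ((m - 1 - k)! : ℝ)) := by
  have h : ∀ i ≤ m - 1, ((m - 1).descFactorial i : ℝ) = ((m - 1)! : ℝ) / ((m - 1 - i)! : ℝ) := by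
    intro i hi
    rw [eq_div_iff (Nat.cast_ne_zero.mpr (Nat.factorial_ne_zero _)),
      ← Nat.factorial_mul_descFactorial hi]
    push_cast
    ring
  have hf : ∀ i : ℕ, ((i ! : ℕ) : ℝ) ≠ 0 := fun i => Nat.cast_ne_zero.mpr (Nat.factorial_ne_zero i)
  have h1 := hf (m - 1)
  have h2 := hf (m - 1 - k)
  have h3 := hf (m - 1 - j)
  have h4 := hf (m - 1 - (k - j))
  rw [gramWeight, h k hk, h j (by omega), h (k - j) (by omega)]
  field_simp

end Matrix

open Matrix

/-! ### Reduction to zero row and column sums. -/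

theorem normalizedOnes_dotProduct_self {r : ℕ} (hr : 1 ≤ r) :
    normalizedOnes r ⬝ᵥ normalizedOnes r = 1 := by
  have h : (r : ℝ) ≠ 0 := by positivity
  simp only [dotProduct, normalizedOnes, one_div, ← mul_inv, Real.mul_self_sqrt (Nat.cast_nonneg r)]
  simp [h]

theorem normalizedOnes_ne_zero {r : ℕ} (hr : 1 ≤ r) : normalizedOnes r ≠ 0 := by
  intro h
  have := normalizedOnes_dotProduct_self hr
  simp [h] at this

theorem permMatrix_mulVec_normalizedOnes {r : ℕ} (P : Equiv.Perm (Fin r)) :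
    P.permMatrix ℝ *ᵥ normalizedOnes r = normalizedOnes r := by
  rw [permMatrix_mulVec]
  rfl

theorem sum_eq_zero_of_mulVec_normalizedOnes {m n : ℕ} (hn : 1 ≤ n)
    {M : Matrix (Fin m) (Fin n) ℝ} (h : M *ᵥ normalizedOnes n = 0) (r : Fin m) :
    ∑ s, M r s = 0 := by
  have h1 := congrFun h r
  simp only [mulVec, dotProduct, normalizedOnes, ← Finset.sum_mul, Pi.zero_apply] at h1
  refine (mul_eq_zero.mp h1).resolve_right ?_
  have : (0 : ℝ) < n := by exact_mod_cast hn
  positivity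

/-- The matrix obtained from `M` by removing the singular value `c` at the normalized all-ones
vectors. -/
noncomputable def deflate {m n : ℕ} (c : ℝ) (M : Matrix (Fin m) (Fin n) ℝ) :
    Matrix (Fin m) (Fin n) ℝ :=
  M - c • vecMulVec (normalizedOnes m) (normalizedOnes n)

section Deflate

variable {m n : ℕ} {M : Matrix (Fin m) (Fin n) ℝ} {c : ℝ}

theorem deflate_mulVec (hn : 1 ≤ n) (h : M *ᵥ normalizedOnes n = c • normalizedOnes m) :
    deflate c M *ᵥ normalizedOnes n = 0 := by
  rw [deflate, sub_mulVec, h, smul_mulVec, vecMulVec_mulVec, normalizedOnes_dotProduct_self hn]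
  simp

theorem transpose_deflate : (deflate c M)ᵀ = deflate c Mᵀ := by
  rw [deflate, deflate, transpose_sub, transpose_smul, transpose_vecMulVec]

theorem deflate_add_mul_mul (A B : Matrix (Fin m) (Fin n) ℝ) (a b : ℝ)
    (P : Equiv.Perm (Fin m)) (S : Equiv.Perm (Fin n)) :
    deflate (a + b) (A + P.permMatrix ℝ * B * (S.permMatrix ℝ)ᵀ) =
      deflate a A + P.permMatrix ℝ * deflate b B * (S.permMatrix ℝ)ᵀ := by
  have h : P.permMatrix ℝ * vecMulVec (normalizedOnes m) (normalizedOnes n) *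
      (S.permMatrix ℝ)ᵀ = vecMulVec (normalizedOnes m) (normalizedOnes n) := by
    rw [mul_vecMulVec, permMatrix_mulVec_normalizedOnes, vecMulVec_mul, vecMul_transpose,
      permMatrix_mulVec_normalizedOnes]
  simp only [deflate, Matrix.mul_sub, Matrix.sub_mul, Matrix.mul_smul, Matrix.smul_mul, h,
    add_smul]
  abel

theorem add_mul_mul_mulVec_normalizedOnes {A B : Matrix (Fin m) (Fin n) ℝ} {a b : ℝ}
    (hA : A *ᵥ normalizedOnes n = a • normalizedOnes m)
    (hB : B *ᵥ normalizedOnes n = b • normalizedOnes m)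
    (P : Equiv.Perm (Fin m)) (S : Equiv.Perm (Fin n)) :
    (A + P.permMatrix ℝ * B * (S.permMatrix ℝ)ᵀ) *ᵥ normalizedOnes n =
      (a + b) • normalizedOnes m := by
  rw [add_mulVec, hA, transpose_permMatrix, ← mulVec_mulVec, ← mulVec_mulVec,
    permMatrix_mulVec_normalizedOnes, hB, mulVec_smul, permMatrix_mulVec_normalizedOnes, add_smul]

theorem transpose_add_mul_mul (A B : Matrix (Fin m) (Fin n) ℝ)
    (P : Equiv.Perm (Fin m)) (S : Equiv.Perm (Fin n)) :
    (A + P.permMatrix ℝ * B * (S.permMatrix ℝ)ᵀ)ᵀ =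
      Aᵀ + S.permMatrix ℝ * Bᵀ * (P.permMatrix ℝ)ᵀ := by
  rw [transpose_add, transpose_mul, transpose_mul, transpose_transpose, Matrix.mul_assoc]

theorem charpoly_deflate (hn : 1 ≤ n) (hm : 1 ≤ m)
    (h : M *ᵥ normalizedOnes n = c • normalizedOnes m)
    (h' : Mᵀ *ᵥ normalizedOnes m = c • normalizedOnes n) :
    (Mᵀ * M).charpoly * X = (X - C (c ^ 2)) * ((deflate c M)ᵀ * deflate c M).charpoly := by
  have : Nonempty (Fin n) := ⟨⟨0, hn⟩⟩
  exact charpoly_transpose_mul_self_mul_X M (normalizedOnes_dotProduct_self hn)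
    (normalizedOnes_dotProduct_self hm) h h'

theorem charpoly_deflate_eq_X_mul (hn : 1 ≤ n) (hm : 1 ≤ m)
    (h : M *ᵥ normalizedOnes n = c • normalizedOnes m)
    (h' : Mᵀ *ᵥ normalizedOnes m = c • normalizedOnes n) {p : ℝ[X]}
    (hp : (Mᵀ * M).charpoly = (X - C (c ^ 2)) * p) :
    ((deflate c M)ᵀ * deflate c M).charpoly = X * p := by
  have h1 := charpoly_deflate hn hm h h'
  apply mul_left_cancel₀ (X_sub_C_ne_zero (c ^ 2))
  rw [← h1, hp]
  ring

theorem factorial_mul_signedCoeff {N : Matrix (Fin n) (Fin n) ℝ} {p : ℝ[X]}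
    (hp : N.charpoly = X * p) {k : ℕ} (hk : k < n) :
    (k ! : ℝ) * signedCoeff (n - 1) p k = minorSum k N := by
  have h := factorial_mul_charpoly_coeff N (k := k) (by simpa using hk.le)
  have h1 : n - k = n - 1 - k + 1 := by omega
  rw [Fintype.card_fin, hp, h1, coeff_X_mul] at h
  rw [signedCoeff, mul_left_comm, h, ← mul_assoc, ← mul_pow]
  simp

end Deflate

/-! ### Comparison of coefficients and the theorem. -/

theorem coeff_rectConv (m n : ℕ) (p q : ℝ[X]) {k : ℕ} (hk : k ≤ n) :
    (rectConv m n p q).coeff (n - k) =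
      (-1) ^ k * ∑ ij ∈ Finset.HasAntidiagonal.antidiagonal k,
      (((n - ij.1)! : ℝ) * ((n - ij.2)! : ℝ)) / ((n ! : ℝ) * ((n - k)! : ℝ)) *
      ((((m - ij.1)! : ℝ) * ((m - ij.2)! : ℝ)) / ((m ! : ℝ) * ((m - k)! : ℝ))) *
      signedCoeff n p ij.1 * signedCoeff n q ij.2 := by
  rw [rectConv, finsetSum_coeff, Finset.sum_eq_single k]
  · rw [coeff_C_mul_X_pow, if_pos rfl]
  · intro l hl hlk
    have := Finset.mem_range.mp hl
    rw [coeff_C_mul_X_pow, if_neg (by omega)]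
  · intro h
    exact absurd (Finset.mem_range.mpr (by omega)) h

theorem coeff_rectConv_eq_zero (m n : ℕ) (p q : ℝ[X]) {d : ℕ} (hd : n < d) :
    (rectConv m n p q).coeff d = 0 := by
  rw [rectConv, finsetSum_coeff]
  refine Finset.sum_eq_zero fun l _ => ?_
  rw [coeff_C_mul_X_pow, if_neg (by omega)]

theorem coeff_expect {ι : Type*} [Fintype ι] (F : ι → ℝ[X]) (d : ℕ) :
    (𝔼 i, F i).coeff d = 𝔼 i, (F i).coeff d := by
  rw [Finset.expect, Finset.expect, coeff_smul, finsetSum_coeff]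

theorem expect_charpoly_transpose_mul {m n : ℕ} (hn : 1 ≤ n) (hmn : n ≤ m)
    {A B : Matrix (Fin m) (Fin n) ℝ}
    (hA : A *ᵥ normalizedOnes n = 0) (hA' : Aᵀ *ᵥ normalizedOnes m = 0)
    (hB : B *ᵥ normalizedOnes n = 0) (hB' : Bᵀ *ᵥ normalizedOnes m = 0)
    {p q : ℝ[X]} (hp : (Aᵀ * A).charpoly = X * p) (hq : (Bᵀ * B).charpoly = X * q) :
    𝔼 P : Equiv.Perm (Fin m), 𝔼 S : Equiv.Perm (Fin n),
      ((A + P.permMatrix ℝ * B * (S.permMatrix ℝ)ᵀ)ᵀ *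
        (A + P.permMatrix ℝ * B * (S.permMatrix ℝ)ᵀ)).charpoly =
      X * rectConv (m - 1) (n - 1) p q := by
  ext d
  simp only [coeff_expect]
  rcases d with _ | d
  -- The constant term corresponds to minors of size `n`, outside the range of the weight formula;
  -- it vanishes because the all-ones vector is always in the kernel.
  · rw [coeff_X_mul_zero]
    refine Finset.expect_eq_zero fun P _ => Finset.expect_eq_zero fun S _ => ?_
    have h := add_mul_mul_mulVec_normalizedOnes (a := 0) (b := 0) (hA.trans (zero_smul _ _).symm)
      (hB.trans (zero_smul _ _).symm) P S
    rw [add_zero, zero_smul] at h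
    rw [← X_dvd_iff]
    have h1 := X_sub_C_dvd_charpoly (N := (A + P.permMatrix ℝ * B * (S.permMatrix ℝ)ᵀ)ᵀ *
        (A + P.permMatrix ℝ * B * (S.permMatrix ℝ)ᵀ)) (c := 0) (normalizedOnes_ne_zero hn)
        (by rw [← mulVec_mulVec, h, mulVec_zero, zero_smul])
    rwa [C_0, sub_zero] at h1
  rw [coeff_X_mul]
  by_cases hd : n ≤ d
  · rw [coeff_rectConv_eq_zero _ _ _ _ (by omega)]
    refine Finset.expect_eq_zero fun P _ => Finset.expect_eq_zero fun S _ => ?_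
    refine coeff_eq_zero_of_natDegree_lt ?_
    rw [charpoly_natDegree_eq_dim, Fintype.card_fin]
    omega
  obtain ⟨k, hk, rfl⟩ : ∃ k < n, d = n - 1 - k := ⟨n - 1 - d, by omega, by omega⟩
  have hm : 1 ≤ m := hn.trans hmn
  have hk0 : (k ! : ℝ) ≠ 0 := Nat.cast_ne_zero.mpr (Nat.factorial_ne_zero k)
  have hkn : k ≤ Fintype.card (Fin n) := by simpa using hk.le
  have hd1 : n - 1 - k + 1 = Fintype.card (Fin n) - k := by
    rw [Fintype.card_fin]
    omega
  rw [coeff_rectConv _ _ _ _ (by omega)]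
  apply mul_left_cancel₀ hk0
  simp only [Finset.mul_expect, hd1, factorial_mul_charpoly_coeff _ hkn]
  simp only [← Finset.mul_expect]
  -- The antidiagonal is swapped because `j` counts the indices belonging to `B`, hence to the
  -- second polynomial `q`.
  rw [expect_minorSum_transpose_mul (by simpa using hk.trans_le hmn) (by simpa using hk) A B
    (sum_eq_zero_of_mulVec_normalizedOnes hn hA) (sum_eq_zero_of_mulVec_normalizedOnes hm hA')
    (sum_eq_zero_of_mulVec_normalizedOnes hn hB) (sum_eq_zero_of_mulVec_normalizedOnes hm hB'),
    mul_left_comm, ← Finset.Nat.sum_antidiagonal_swap,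
    Finset.Nat.sum_antidiagonal_eq_sum_range_succ_mk, Finset.mul_sum, Finset.mul_sum,
    Finset.mul_sum]
  refine Finset.sum_congr rfl fun j hj => ?_
  have hjk : j ≤ k := Nat.lt_succ_iff.mp (Finset.mem_range.mp hj)
  rw [Fintype.card_fin, Fintype.card_fin, gramWeight_eq (by omega) hjk,
    gramWeight_eq (by omega) hjk, ← factorial_mul_signedCoeff hp (k := k - j) (by omega),
    ← factorial_mul_signedCoeff hq (k := j) (by omega), ← Nat.choose_mul_factorial_mul_factorial hjk]
  simp only [Prod.swap_prod_mk]
  push_cast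
  ring

theorem directSum_mul_bipartite_mul {m n : ℕ} (P : Matrix (Fin m) (Fin m) ℝ)
    (S : Matrix (Fin n) (Fin n) ℝ) (A B : Matrix (Fin m) (Fin n) ℝ) :
    bipartite A + directSum P S * bipartite B * (directSum P S)ᵀ =
      bipartite (A + P * B * Sᵀ) := by
  simp [bipartite, directSum, fromBlocks_transpose, fromBlocks_multiply, fromBlocks_add,
    transpose_mul, Matrix.mul_assoc]

theorem charpoly_bipartite {m n : ℕ} (hmn : n ≤ m) (M : Matrix (Fin m) (Fin n) ℝ) :
    (bipartite M).charpoly = X ^ (m - n) * squareSubst (Mᵀ * M).charpoly := by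
  rw [bipartite, charpoly_fromBlocks_zero_transpose M (by simpa using hmn), Fintype.card_fin,
    Fintype.card_fin, squareSubst]

theorem expect_squareSubst {ι : Type*} [Fintype ι] (r : ℝ[X]) (F : ι → ℝ[X]) :
    𝔼 i, r * squareSubst (F i) = r * squareSubst (𝔼 i, F i) := by
  rw [← Finset.mul_expect, squareSubst, Finset.expect, Finset.expect, smul_comp, Polynomial.sum_comp]
  rfl

/-- `𝔼 P, 𝔼 S` is the average over all pairs of permutations, that is, the expectation over
independent uniformly random permutation matrices. -/
theorem theorem2p7 (m n : ℕ) (hn : 1 ≤ n) (hmn : n ≤ m)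
    (A B : Matrix (Fin m) (Fin n) ℝ) (a b : ℝ)
    (hA : A *ᵥ normalizedOnes n = a • normalizedOnes m)
    (hA' : Aᵀ *ᵥ normalizedOnes m = a • normalizedOnes n)
    (hB : B *ᵥ normalizedOnes n = b • normalizedOnes m)
    (hB' : Bᵀ *ᵥ normalizedOnes m = b • normalizedOnes n) :
    (X - C (a ^ 2)) ∣ (Aᵀ * A).charpoly ∧
    (X - C (b ^ 2)) ∣ (Bᵀ * B).charpoly ∧
    ∀ p q : ℝ[X],
      (Aᵀ * A).charpoly = (X - C (a ^ 2)) * p →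
      (Bᵀ * B).charpoly = (X - C (b ^ 2)) * q →
      (𝔼 P : Equiv.Perm (Fin m), 𝔼 S : Equiv.Perm (Fin n),
          (bipartite A +
            directSum (P.permMatrix ℝ) (S.permMatrix ℝ) * bipartite B *
              (directSum (P.permMatrix ℝ) (S.permMatrix ℝ))ᵀ).charpoly)
        = X ^ (m - n) *
            squareSubst ((X - C ((a + b) ^ 2)) * rectConv (m - 1) (n - 1) p q) ∧
      squareSubst ((X - C ((a + b) ^ 2)) * rectConv (m - 1) (n - 1) p q)
        = (X ^ 2 - C ((a + b) ^ 2)) * squareSubst (rectConv (m - 1) (n - 1) p q) := by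

  have hm : 1 ≤ m := hn.trans hmn
  have hdvd : ∀ {M : Matrix (Fin m) (Fin n) ℝ} {c : ℝ},
      M *ᵥ normalizedOnes n = c • normalizedOnes m →
      Mᵀ *ᵥ normalizedOnes m = c • normalizedOnes n →
      (X - C (c ^ 2)) ∣ (Mᵀ * M).charpoly := fun {M c} h h' =>
    X_sub_C_dvd_charpoly (normalizedOnes_ne_zero hn)
      (by rw [← mulVec_mulVec, h, mulVec_smul, h', smul_smul, pow_two])
  refine ⟨hdvd hA hA', hdvd hB hB', fun p q hp hq => ⟨?_, ?_⟩⟩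
  · simp only [directSum_mul_bipartite_mul, charpoly_bipartite hmn, expect_squareSubst]
    congr 2
    have h0 := expect_charpoly_transpose_mul hn hmn (deflate_mulVec hn hA)
      (transpose_deflate (M := A) ▸ deflate_mulVec hm hA') (deflate_mulVec hn hB)
      (transpose_deflate (M := B) ▸ deflate_mulVec hm hB')
      (charpoly_deflate_eq_X_mul hn hm hA hA' hp) (charpoly_deflate_eq_X_mul hn hm hB hB' hq)
    have h1 : ∀ P : Equiv.Perm (Fin m), ∀ S : Equiv.Perm (Fin n),
        ((A + P.permMatrix ℝ * B * (S.permMatrix ℝ)ᵀ)ᵀ *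
          (A + P.permMatrix ℝ * B * (S.permMatrix ℝ)ᵀ)).charpoly * X = _ := fun P S =>
      charpoly_deflate hn hm (add_mul_mul_mulVec_normalizedOnes hA hB P S)
        (by rw [transpose_add_mul_mul]; exact add_mul_mul_mulVec_normalizedOnes hA' hB' S P)
    simp only [deflate_add_mul_mul] at h1
    -- Multiplying by `X` makes the deflation identity for each pair `P`, `S` applicable inside the
    -- expectation; its factor `X - C ((a + b) ^ 2)` is the same for all pairs.
    apply mul_right_cancel₀ (X_ne_zero (R := ℝ))
    simp only [Finset.expect_mul, h1]
    simp only [← Finset.mul_expect, h0]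
    ring
  · simp [squareSubst]
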